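/- Let $\mathbf{k}$ be an algebraically closed field and let $\Lambda=\mathbf{k}Q/I$ be a gentle algebra: $Q$ is a finite quiver with at most two arrows starting and at most two arrows ending at each vertex, $I$ is generated by paths of length two, for each arrow $a$ there is at most one arrow $b$ with $ab$ a path not in $I$ and at most one with $ab$ a path in $I$, and dually on the other side of $a$, and paths not in $I$ have bounded length. Paths are composed from right to left, and $P(x)=\Lambda e_x$. A homotopy letter is a nontrivial path $p\notin I$ (direct letter) or the formal inverse $\overline p$ of such a path (inverse letter); $\overline p$ starts where $p$ ends and ends where $p$ starts. Call a cyclic word $\sigma=\sigma_\ell\cdots\sigma_1$ of homotopy letters a closed homotopy word if, for any two cyclically consecutive letters $LL'$ (including $L=\sigma_1$, $L'=\sigma_\ell$), $L$ starts where $L'$ ends, two consecutive direct letters $p\,q$ satisfy $pq\in I$, two consecutive inverse letters $\overline p\,\overline q$ satisfy $qp\in I$, a direct letter next to an inverse letter does not cancel (no subword $a\overline a$ or $\overline a a$ with $a$ an arrow), and if $\sigma$ has as many direct as inverse letters. A homotopy band is a nonempty closed homotopy word that is not a proper power of another word. For a closed homotopy word $\sigma$ of length $\ell \geq 1$, a chosen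 direct letter of $\sigma$ and $\lambda\in\mathbf{k}$, let $B^{\bullet}_{\sigma,\lambda}$ be the cochain complex of projective left $\Lambda$-modules induced by the unfolded diagram of $\sigma$: it has one summand $P(x)$ for each of the $\ell$ cyclic positions (the left end point of each letter, $x$ being the vertex at which that letter ends). The first position, the left end of $\sigma_\ell$, lies in degree $0$, and reading from left to right the degree goes up by one along a direct letter and down by one along an inverse letter. The differential is the sum of the maps given by the letters: a letter $p$ or $\overline p$, with $p$ a path from $y$ to $x$, gives the map $P(x)\to P(y)$, $u\mapsto up$ (from left to right for $p$, from right to left for $\overline p$), and the map of the chosen direct letter is multiplied by $\lambda$. Let $\tau$ be a homotopy band, $n\ge 1$, $\sigma=\tau^n$ and $\lambda\in\mathbf{k}^*$, and let $\omega\in\mathbf{k}$ be a primitive $n$-th root of unity (such $\omega$ exists if and only if the characteristic of $\mathbf{k}$ does not divide $n$). Then $\lambda$ has an $n$-th root in $\mathbf{k}$ and, for every $\mu\in\mathbf{k}$ with $\mu^n=\lambda$ and every choice of the direct letters of $\sigma$ and of $\tau$ on which the scalars are placed, there is an isomorphism of complexes of $\Lambda$-modules $$B^{\bullet}_{\sigma,\lambda}\;\cong\;\bigoplus_{i=1}^n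 B^{\bullet}_{\tau,\omega^i\mu}.$$ -/

import Mathlib

open CategoryTheory CategoryTheory.Limits

universe u v w

noncomputable section

namespace GentleBand

/-! ### Bound quivers and their algebras

Paths are composed from right to left: `a b` means first `b`, then `a`.  An arrow `a` of the
quiver `V` is an element of `Quiver.Total V`; it starts at `a.left` and ends at `a.right`. -/

/-- Generators of the path algebra: the trivial paths and the arrows. -/
inductive PathGen (V : Type v) [Quiver.{w} V] : Type max v w
  | triv (x : V) : PathGen V
  | arrow (a : Quiver.Total V) : PathGen V

section Algebra

variable (k : Type u) [Field k] (V : Type v) [Quiver.{w} V] [Fintype V]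

/-- The defining relations of the path algebra of a quiver with finitely many vertices: the
trivial paths are orthogonal idempotents with sum `1`, and `a = e_{end of a} a = a e_{start of a}`
for every arrow `a`. -/
inductive PathRel : FreeAlgebra k (PathGen V) → FreeAlgebra k (PathGen V) → Prop
  | idem (x : V) :
      PathRel (FreeAlgebra.ι k (PathGen.triv x) * FreeAlgebra.ι k (PathGen.triv x))
        (FreeAlgebra.ι k (PathGen.triv x))
  | orth (x y : V) (h : x ≠ y) :
      PathRel (FreeAlgebra.ι k (PathGen.triv x) * FreeAlgebra.ι k (PathGen.triv y)) 0
  | unit : PathRel (∑ x : V, FreeAlgebra.ι k (PathGen.triv x)) 1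
  | ends (a : Quiver.Total V) :
      PathRel (FreeAlgebra.ι k (PathGen.triv a.right) * FreeAlgebra.ι k (PathGen.arrow a))
        (FreeAlgebra.ι k (PathGen.arrow a))
  | starts (a : Quiver.Total V) :
      PathRel (FreeAlgebra.ι k (PathGen.arrow a) * FreeAlgebra.ι k (PathGen.triv a.left))
        (FreeAlgebra.ι k (PathGen.arrow a))

/-- The path algebra `kQ`. -/
def PathAlgebra : Type max u v w := RingQuot (PathRel k V)

instance : Ring (PathAlgebra k V) := inferInstanceAs (Ring (RingQuot (PathRel k V)))

instance : Algebra k (PathAlgebra k V) := inferInstanceAs (Algebra k (RingQuot (PathRel k V)))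

/-- The quotient map from the free algebra onto the path algebra. -/
def pathMk : FreeAlgebra k (PathGen V) →ₐ[k] PathAlgebra k V := RingQuot.mkAlgHom k (PathRel k V)

variable {V}

/-- The generators of the ideal `I`: the products `a b` of two arrows with `R a b`. -/
inductive ZeroRel (R : Quiver.Total V → Quiver.Total V → Prop) :
    PathAlgebra k V → PathAlgebra k V → Prop
  | zero (a b : Quiver.Total V) (h : R a b) :
      ZeroRel R
        (pathMk k V (FreeAlgebra.ι k (PathGen.arrow a)) *
          pathMk k V (FreeAlgebra.ι k (PathGen.arrow b))) 0

/-- The algebra `kQ/I`, where `I` is the two-sided ideal generated by the paths `a b` of length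
two with `R a b`. -/
def BoundAlgebra (R : Quiver.Total V → Quiver.Total V → Prop) : Type max u v w :=
  RingQuot (ZeroRel k R)

variable (R : Quiver.Total V → Quiver.Total V → Prop)

instance : Ring (BoundAlgebra k R) := inferInstanceAs (Ring (RingQuot (ZeroRel k R)))

instance : Algebra k (BoundAlgebra k R) := inferInstanceAs (Algebra k (RingQuot (ZeroRel k R)))

/-- The quotient map `kQ → kQ/I`. -/
def boundMk : PathAlgebra k V →ₐ[k] BoundAlgebra k R := RingQuot.mkAlgHom k (ZeroRel k R)

/-- The class of a generator of the path algebra in `kQ/I`. -/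
def gen (g : PathGen V) : BoundAlgebra k R :=
  boundMk k R (pathMk k V (FreeAlgebra.ι k g))

/-- The trivial path `e_x` in `kQ/I`. -/
def triv (x : V) : BoundAlgebra k R := gen k R (PathGen.triv x)

/-- The arrow `a` in `kQ/I`. -/
def arrow (a : Quiver.Total V) : BoundAlgebra k R := gen k R (PathGen.arrow a)

lemma arrow_mul_triv (a : Quiver.Total V) : arrow k R a * triv k R a.left = arrow k R a := by
  have h : pathMk k V _ = pathMk k V _ := RingQuot.mkAlgHom_rel k (PathRel.starts a)
  simp only [arrow, triv, gen, ← map_mul]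
  rw [h]

lemma arrow_mul_arrow {a b : Quiver.Total V} (hab : R a b) :
    arrow k R a * arrow k R b = 0 := by
  have h : boundMk k R _ = boundMk k R _ := RingQuot.mkAlgHom_rel k (ZeroRel.zero a b hab)
  simp only [arrow, gen, ← map_mul]
  rw [map_mul, h, map_zero]

/-- The indecomposable projective left module `P(x) = Λ e_x`. -/
def proj (x : V) : Submodule (BoundAlgebra k R) (BoundAlgebra k R) :=
  Submodule.span (BoundAlgebra k R) {triv k R x}

/-- Right multiplication `P(x) → P(y)`, `u ↦ u p`, by an element `p` with `p e_y = p`. -/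
def rightMul (x y : V) (p : BoundAlgebra k R) (hp : p * triv k R y = p) :
    proj k R x →ₗ[BoundAlgebra k R] proj k R y where
  toFun u := ⟨u.1 * p, Submodule.mem_span_singleton.2 ⟨u.1 * p, by
    rw [smul_eq_mul, mul_assoc, hp]⟩⟩
  map_add' a b := Subtype.ext (add_mul a.1 b.1 p)
  map_smul' c a := Subtype.ext (mul_assoc c a.1 p)

end Algebra

/-- The bound quiver `(V, R)` is gentle: it is finite; at most two arrows start, and at most two
end, at each vertex; the ideal is generated by the paths `a b` of length two with `R a b`; for
each arrow `a` there is at most one arrow `b` with `a b` a path outside the ideal and at most one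
with `a b` a path in the ideal, and likewise on the other side of `a`; the lengths of the paths
outside the ideal are bounded (so that `kQ/I` is finite-dimensional). -/
structure IsGentle {V : Type v} [Quiver.{w} V] (R : Quiver.Total V → Quiver.Total V → Prop) :
    Prop where
  finite_vertices : Finite V
  finite_arrows : Finite (Quiver.Total V)
  composable : ∀ a b, R a b → a.left = b.right
  out_le_two : ∀ x : V, {a : Quiver.Total V | a.left = x}.encard ≤ 2
  in_le_two : ∀ x : V, {a : Quiver.Total V | a.right = x}.encard ≤ 2
  unique_before : ∀ a b b', a.left = b.right → ¬ R a b → a.left = b'.right → ¬ R a b' → b = b'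
  unique_after : ∀ a c c', c.left = a.right → ¬ R c a → c'.left = a.right → ¬ R c' a → c = c'
  unique_before_rel : ∀ a b b', R a b → R a b' → b = b'
  unique_after_rel : ∀ a c c', R c a → R c' a → c = c'
  bounded : ∃ N : ℕ, ∀ l : List (Quiver.Total V),
    l.IsChain (fun a b => a.left = b.right ∧ ¬ R a b) → l.length ≤ N

/-! ### Homotopy letters and words -/

section Words

variable {V : Type v} [Quiver.{w} V] (R : Quiver.Total V → Quiver.Total V → Prop)

/-- A nontrivial path `a_m ⋯ a_1` in `(Q, I)`, i.e. a path of the quiver that does not lie in the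
ideal; the list of its arrows is `[a_m, …, a_1]`. -/
structure BPath where
  arrows : List (Quiver.Total V)
  ne_nil : arrows ≠ []
  chain : arrows.IsChain (fun a b => a.left = b.right ∧ ¬ R a b)

variable {R}

namespace BPath

/-- The first arrow `a_1` of the path `a_m ⋯ a_1`. -/
def firstArrow (p : BPath R) : Quiver.Total V := p.arrows.getLast p.ne_nil

/-- The last arrow `a_m` of the path `a_m ⋯ a_1`. -/
def lastArrow (p : BPath R) : Quiver.Total V := p.arrows.head p.ne_nil

/-- The vertex at which a path starts. -/
def source (p : BPath R) : V := p.firstArrow.left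

/-- The vertex at which a path ends. -/
def target (p : BPath R) : V := p.lastArrow.right

/-- The class of a path in `kQ/I`. -/
def elem (k : Type u) [Field k] [Fintype V] (p : BPath R) : BoundAlgebra k R :=
  (p.arrows.map (arrow k R)).prod

end BPath

variable (R) in
/-- A homotopy letter: a nontrivial path in `(Q, I)` (direct letter) or the formal inverse of such
a path (inverse letter). -/
inductive Letter
  | dir (p : BPath R) : Letter
  | inv (p : BPath R) : Letter

namespace Letter

/-- The vertex at which a letter starts. -/
def s : Letter R → V
  | dir p => p.source
  | inv p => p.target

/-- The vertex at which a letter ends. -/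
def e : Letter R → V
  | dir p => p.target
  | inv p => p.source

/-- `1` for a direct letter, `-1` for an inverse letter. -/
def sgn : Letter R → ℤ
  | dir _ => 1
  | inv _ => -1

/-- The letter is direct. -/
def IsDirect : Letter R → Prop
  | dir _ => True
  | inv _ => False

/-- `L L'` may occur as two consecutive letters, `L` to the left of `L'`, in a homotopy letter
partition: `L` starts where `L'` ends; two paths (or two inverse paths) meet in a relation (so that
they do not merge into one letter); a path and an inverse path do not cancel. -/
def Adj (L L' : Letter R) : Prop :=
  L.s = L'.e ∧
    match L, L' with
    | dir p, dir q => R p.firstArrow q.lastArrow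
    | inv p, inv q => R q.firstArrow p.lastArrow
    | dir p, inv q => p.firstArrow ≠ q.firstArrow
    | inv p, dir q => p.lastArrow ≠ q.lastArrow

end Letter

/-- A word of length `ℓ` in homotopy letters, written from left to right, that is closed as a
homotopy string (so that all its powers are homotopy strings), and has as many direct letters as
inverse ones.  The word `σ = σ_ℓ ⋯ σ_1` is the function with values `σ_ℓ, …, σ_1`. -/
structure IsClosedWord {ℓ : ℕ} (σ : Fin ℓ → Letter R) : Prop where
  adj : ∀ l, (σ l).Adj (σ (finRotate ℓ l))
  balanced : ∑ l, (σ l).sgn = 0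

/-- A homotopy band: a nonempty closed word as above that is not a proper power of a word. -/
structure IsHomotopyBand {ℓ : ℕ} (σ : Fin ℓ → Letter R) : Prop extends IsClosedWord σ where
  pos : 0 < ℓ
  primitive : ∀ (m d : ℕ) (h : ℓ = m * d) (ρ : Fin d → Letter R),
    σ = Fin.repeat m ρ ∘ Fin.cast h → m = 1

/-- The power `τ^n` of a closed word is a closed word. -/
lemma IsClosedWord.pow {ℓ : ℕ} {τ : Fin ℓ → Letter R} (h : IsClosedWord τ) (n : ℕ) :
    IsClosedWord (Fin.repeat n τ) where
  adj l := by
    have key : (finRotate (n * ℓ) l).modNat = finRotate ℓ l.modNat := by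
      have hpos : 0 < n * ℓ := l.pos
      have hℓ : 0 < ℓ := Nat.pos_of_mul_pos_left hpos
      have : NeZero (n * ℓ) := ⟨hpos.ne'⟩
      have : NeZero ℓ := ⟨hℓ.ne'⟩
      apply Fin.ext
      rw [finRotate_apply, finRotate_apply]
      simp [Fin.val_add, Fin.modNat]
    simp only [Fin.repeat_apply, key]
    exact h.adj _
  balanced := by
    rw [← (finProdFinEquiv (m := n) (n := ℓ)).sum_comp, Fintype.sum_prod_type]
    refine Finset.sum_eq_zero fun r _ => ?_
    rw [← h.balanced]
    refine Finset.sum_congr rfl fun j _ => ?_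
    rw [Fin.repeat_apply]
    have : (finProdFinEquiv (r, j)).modNat = j :=
      congrArg Prod.snd (finProdFinEquiv.symm_apply_apply (r, j))
    rw [this]

/-! ### The complex of a closed word -/

/-- The vertex of the quiver at position `j` of the (cyclic) unfolded diagram; position `j` is the
left end of the `j`-th letter, and its right end is position `j + 1` (cyclically). -/
def vertex {ℓ : ℕ} (σ : Fin ℓ → Letter R) (j : Fin ℓ) : V := (σ j).e

/-- The cohomological degree of position `j`: it is `0` at the first position and goes up by one
along a direct letter, down by one along an inverse letter. -/
def deg {ℓ : ℕ} (σ : Fin ℓ → Letter R) (j : Fin ℓ) : ℤ := ∑ i ∈ Finset.Iio j, (σ i).sgn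

section Complex

variable (k : Type u) [Field k] [Fintype V]

open Classical in
/-- The contribution of the `l`-th letter to the component of the differential from position `i` to
position `j`: a direct letter `p` is an arrow `l → l + 1` of the unfolded diagram and an inverse
letter is an arrow `l + 1 → l`; in both cases it stands for right multiplication by the path. -/
def letterEntry {ℓ : ℕ} (σ : Fin ℓ → Letter R) (l i j : Fin ℓ) : BoundAlgebra k R :=
  match σ l with
  | Letter.dir p => if i = l ∧ j = finRotate ℓ l then p.elem k else 0
  | Letter.inv p => if i = finRotate ℓ l ∧ j = l then p.elem k else 0

/-- The component of the differential from position `i` to position `j`, where the letter at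
position `m` carries the scalar `c` and all other letters carry the scalar `1`. -/
def entry {ℓ : ℕ} (σ : Fin ℓ → Letter R) (m : Fin ℓ) (c : k) (i j : Fin ℓ) : BoundAlgebra k R :=
  ∑ l, (if l = m then c else 1) • letterEntry k σ l i j

variable {k}

lemma elem_mul_triv (p : BPath R) : p.elem k * triv k R p.source = p.elem k := by
  have h : p.arrows = p.arrows.dropLast ++ [p.firstArrow] :=
    (List.dropLast_append_getLast p.ne_nil).symm
  have h' : p.elem k = ((p.arrows.dropLast ++ [p.firstArrow]).map (arrow k R)).prod := by
    rw [← h]; rfl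
  rw [h']
  simp [mul_assoc, BPath.source, arrow_mul_triv]

lemma elem_mul_elem (p q : BPath R) (h : R p.firstArrow q.lastArrow) :
    p.elem k * q.elem k = 0 := by
  have hp : p.elem k = ((p.arrows.dropLast ++ [p.firstArrow]).map (arrow k R)).prod := by
    rw [BPath.firstArrow, List.dropLast_append_getLast]; rfl
  have hq : q.elem k = ((q.lastArrow :: q.arrows.tail).map (arrow k R)).prod := by
    rw [BPath.lastArrow, List.cons_head_tail]; rfl
  rw [hp, hq, List.map_append, List.prod_append, List.map_cons, List.prod_cons, List.map_cons,
    List.prod_cons, List.map_nil, List.prod_nil, mul_one, mul_assoc,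
    ← mul_assoc (arrow k R _) (arrow k R _), arrow_mul_arrow k R h, zero_mul, mul_zero]

lemma entry_mul_triv {ℓ : ℕ} {σ : Fin ℓ → Letter R} (h : IsClosedWord σ) (m : Fin ℓ) (c : k)
    (i j : Fin ℓ) : entry k σ m c i j * triv k R (vertex σ j) = entry k σ m c i j := by
  unfold entry
  rw [Finset.sum_mul]
  refine Finset.sum_congr rfl fun l _ => ?_
  rw [smul_mul_assoc]
  congr 1
  unfold letterEntry
  have hadj := (h.adj l).1
  split
  · rename_i p hp
    split_ifs with hc
    · have : vertex σ j = p.source := by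
        rw [vertex, hc.2, ← hadj, hp]; rfl
      rw [this, elem_mul_triv]
    · exact zero_mul _
  · rename_i p hp
    split_ifs with hc
    · have : vertex σ j = p.source := by
        rw [vertex, hc.2, hp]; rfl
      rw [this, elem_mul_triv]
    · exact zero_mul _

lemma letterEntry_mul {ℓ : ℕ} {σ : Fin ℓ → Letter R} (h : IsClosedWord σ) (l l' i j t : Fin ℓ) :
    letterEntry k σ l i j * letterEntry k σ l' j t = 0 := by
  have hl := (h.adj l).2
  have hl' := (h.adj l').2
  rcases hp : σ l with p | p <;> rcases hq : σ l' with q | q <;>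
    simp only [letterEntry, hp, hq] <;> split_ifs with h1 h2 <;>
    first | exact zero_mul _ | exact mul_zero _ | skip
  · have e : l' = finRotate ℓ l := h2.1.symm.trans h1.2
    rw [← e, hp, hq] at hl
    exact elem_mul_elem p q hl
  · have e : l = l' := (finRotate ℓ).injective (h1.2.symm.trans h2.1)
    rw [e, hq] at hp
    cases hp
  · have e : l = l' := h1.2.symm.trans h2.1
    rw [e, hq] at hp
    cases hp
  · have e : l = finRotate ℓ l' := h1.2.symm.trans h2.1
    rw [← e, hp, hq] at hl'
    exact elem_mul_elem p q hl'

lemma entry_mul_entry {ℓ : ℕ} {σ : Fin ℓ → Letter R} (h : IsClosedWord σ) (m : Fin ℓ) (c : k)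
    (i j t : Fin ℓ) : entry k σ m c i j * entry k σ m c j t = 0 := by
  unfold entry
  rw [Finset.sum_mul_sum]
  refine Finset.sum_eq_zero fun l _ => Finset.sum_eq_zero fun l' _ => ?_
  rw [smul_mul_smul_comm, letterEntry_mul h, smul_zero]

/-- The component `⨁_{deg j = a} P(vertex j) → ⨁_{deg j = b} P(vertex j)` of the differential. -/
def blockMap {ℓ : ℕ} {σ : Fin ℓ → Letter R} (h : IsClosedWord σ) (m : Fin ℓ) (c : k) (a b : ℤ) :
    ((j : {j : Fin ℓ // deg σ j = a}) → proj k R (vertex σ j)) →ₗ[BoundAlgebra k R]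
      ((j : {j : Fin ℓ // deg σ j = b}) → proj k R (vertex σ j)) :=
  LinearMap.pi fun j => ∑ i : {i : Fin ℓ // deg σ i = a},
    (rightMul k R (vertex σ i) (vertex σ j) (entry k σ m c i j) (entry_mul_triv h m c i j)).comp
      (LinearMap.proj i)

lemma blockMap_comp {ℓ : ℕ} {σ : Fin ℓ → Letter R} (h : IsClosedWord σ) (m : Fin ℓ) (c : k)
    (a b d : ℤ) : (blockMap h m c b d).comp (blockMap h m c a b) = 0 := by
  refine LinearMap.ext fun u => funext fun t => Subtype.ext ?_
  simp only [blockMap, LinearMap.comp_apply, LinearMap.pi_apply, LinearMap.sum_apply,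
    LinearMap.proj_apply, rightMul, LinearMap.coe_mk, AddHom.coe_mk, Submodule.coe_sum,
    LinearMap.zero_apply, Pi.zero_apply, Submodule.coe_zero]
  refine Finset.sum_eq_zero fun j _ => ?_
  rw [Finset.sum_mul]
  refine Finset.sum_eq_zero fun i _ => ?_
  rw [mul_assoc, entry_mul_entry h, mul_zero]

/-- The complex of projective `kQ/I`-modules induced by the unfolded diagram of the closed word `σ`
in which the scalar `c` is placed on the letter at position `m`.  In degree `a` it is the direct sum
of the modules `P(vertex j)` over the positions `j` of degree `a`. -/
def bandComplex {ℓ : ℕ} {σ : Fin ℓ → Letter R} (h : IsClosedWord σ) (m : Fin ℓ) (c : k) :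
    CochainComplex (ModuleCat.{max u v w} (BoundAlgebra k R)) ℤ where
  X a := ModuleCat.of (BoundAlgebra k R)
    ((j : {j : Fin ℓ // deg σ j = a}) → proj k R (vertex σ j))
  d a b := if a + 1 = b then ModuleCat.ofHom (blockMap h m c a b) else 0
  shape a b hab := if_neg hab
  d_comp_d' a b d hab hbd := by
    have hab' : a + 1 = b := hab
    have hbd' : b + 1 = d := hbd
    rw [if_pos hab', if_pos hbd', ← ModuleCat.ofHom_comp, blockMap_comp]
    rfl

end Complex

instance hasFiniteBiproducts_complex (S : Type u) [Ring S] :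
    HasFiniteBiproducts (CochainComplex (ModuleCat.{u} S) ℤ) :=
  Abelian.hasFiniteBiproducts

end Words

end GentleBand

end

/-! Write `σ = τ^n` and let `x` be an `n`-th root of `c`. Rescaling the summands of `B_{σ,c}` by a
gauge `g` spreads the scalar `c` at `m` into scalars `x` on all `n` copies of the letter `m'`. Such
a `g` exists on the cycle of `n * ℓ` positions because the total scalar around it is the same on
both sides, `x ^ n = c` (`gauge_finRotate`). After this rescaling, repeating a chain of `τ` along
the `n` blocks and summing the blocks are chain maps between `B_{τ,x}` and `B_{σ,c}`
(`inclMatrix_intertwines`, `foldMatrix_intertwines`); degrees match because `τ` is balanced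
(`deg_repeat`).

Now let `x` run through the roots `ω^i μ`. Including with one root and folding with another gives a
geometric sum over the blocks in a power of `ω`, so orthogonality of the characters of `ℤ/n` makes
it the Kronecker delta, the factor `1/n` being built into the folding (`inclMatrix_mul_foldMatrix`).
Both sides have `n * ℓ` positions, so the one-sided inverse is two-sided
(`sum_foldMatrix_mul_inclMatrix`), and these maps form a biproduct. All of this takes place in
scalar matrices acting on chains through `scalarMap`. -/

noncomputable section

namespace GentleBand

/-! ### Positions of a power as pairs (block, position in the block). -/

section Index

variable {n ℓ : ℕ}

lemma modNat_finProdFinEquiv (r : Fin n) (j : Fin ℓ) : (finProdFinEquiv (r, j)).modNat = j :=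
  congrArg Prod.snd (finProdFinEquiv.symm_apply_apply (r, j))

lemma divNat_finProdFinEquiv (r : Fin n) (j : Fin ℓ) : (finProdFinEquiv (r, j)).divNat = r :=
  congrArg Prod.fst (finProdFinEquiv.symm_apply_apply (r, j))

lemma val_modNat (p : Fin (n * ℓ)) : (p.modNat : ℕ) = p % ℓ := rfl

lemma val_divNat (p : Fin (n * ℓ)) : (p.divNat : ℕ) = p / ℓ := rfl

lemma val_finRotate {N : ℕ} (p : Fin N) : (finRotate N p : ℕ) = ((p : ℕ) + 1) % N := by
  have : NeZero N := ⟨p.pos.ne'⟩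
  rw [finRotate_apply, Fin.val_add]
  simp

lemma modNat_finRotate (p : Fin (n * ℓ)) :
    (finRotate (n * ℓ) p).modNat = finRotate ℓ p.modNat := by
  apply Fin.ext
  rw [val_modNat, val_finRotate, val_finRotate, val_modNat, Nat.mod_mod_of_dvd _ (Dvd.intro_left n rfl),
    Nat.mod_add_mod]

/-- Turns the sums over a fibre of the folding into sums over the block index, where the roots of
unity act. -/
lemma sum_fiber_modNat {M : Type*} [AddCommMonoid M] (j : Fin ℓ) (F : Fin (n * ℓ) → M) :
    ∑ p, (if p.modNat = j then F p else 0) = ∑ r : Fin n, F (finProdFinEquiv (r, j)) := by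
  rw [← (finProdFinEquiv (m := n) (n := ℓ)).sum_comp, Fintype.sum_prod_type]
  simp [modNat_finProdFinEquiv]

end Index

/-! ### Degrees on a power of a word. -/

section Words

variable {V : Type v} [Quiver.{w} V] {R : Quiver.Total V → Quiver.Total V → Prop}

lemma deg_eq_sum_range {ℓ : ℕ} (σ : Fin ℓ → Letter R) (j : Fin ℓ) (F : ℕ → ℤ)
    (hF : ∀ i : Fin ℓ, F i = (σ i).sgn) : deg σ j = ∑ i ∈ Finset.range j, F i := by
  have : (Finset.Iio j).map Fin.valEmbedding = Finset.range j := by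
    rw [Fin.map_valEmbedding_Iio, Nat.Iio_eq_range]
  rw [← this, Finset.sum_map]
  exact Finset.sum_congr rfl fun i _ => (hF i).symm

/-- The degree on a power of a balanced word is the periodic extension of the degree. -/
lemma deg_repeat {ℓ : ℕ} {τ : Fin ℓ → Letter R} (h : IsClosedWord τ) (n : ℕ)
    (p : Fin (n * ℓ)) : deg (Fin.repeat n τ) p = deg τ p.modNat := by
  have hℓ : 0 < ℓ := p.modNat.pos
  let F : ℕ → ℤ := fun i => (τ ⟨i % ℓ, Nat.mod_lt i hℓ⟩).sgn
  have hF : ∀ i : Fin ℓ, F i = (τ i).sgn := fun i => by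
    simp only [F, Nat.mod_eq_of_lt i.2]
  have hper : ∀ r i, F (r * ℓ + i) = F i := fun r i => by
    simp [F, Nat.add_mod]
  -- Complete blocks do not change the degree, since `τ` has as many direct as inverse letters.
  have hsum : ∀ r, ∑ i ∈ Finset.range (r * ℓ), F i = 0 := by
    intro r
    induction r with
    | zero => simp
    | succ r ih =>
      rw [Nat.succ_mul, Finset.sum_range_add, ih, zero_add]
      simp only [hper]
      rw [← Fin.sum_univ_eq_sum_range, ← h.balanced]
      exact Finset.sum_congr rfl fun i _ => hF i
  rw [deg_eq_sum_range (Fin.repeat n τ) p F fun i => rfl, deg_eq_sum_range τ p.modNat F hF]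
  have hp : (p : ℕ) = p / ℓ * ℓ + p.modNat := by
    rw [val_modNat]; exact (Nat.div_add_mod' _ _).symm
  rw [hp, Finset.sum_range_add, hsum, zero_add]
  simp only [hper]

end Words

/-! ### Closed form of the entries of the differential. -/

section Entries

variable {V : Type v} [Quiver.{w} V] {R : Quiver.Total V → Quiver.Total V → Prop}
variable (k : Type u) [Field k] [Fintype V]

/-- The class of the path of a direct letter, and `0` for an inverse letter. -/
def Letter.dirElem : Letter R → BoundAlgebra k R
  | .dir p => p.elem k
  | .inv _ => 0

/-- The class of the path of an inverse letter, and `0` for a direct letter. -/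
def Letter.invElem : Letter R → BoundAlgebra k R
  | .dir _ => 0
  | .inv p => p.elem k

variable {k}

lemma Letter.invElem_of_isDirect {L : Letter R} (h : L.IsDirect) : L.invElem k = 0 := by
  cases L
  · rfl
  · exact h.elim

/-- The conditions on `l` are outermost so that the sum over letters in `entry` collapses to the
letters at `i` and at `j`. -/
lemma letterEntry_eq {ℓ : ℕ} (σ : Fin ℓ → Letter R) (l i j : Fin ℓ) :
    letterEntry k σ l i j =
      (if l = i then (if j = finRotate ℓ i then (σ i).dirElem k else 0) else 0) +
      (if l = j then (if i = finRotate ℓ j then (σ j).invElem k else 0) else 0) := by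
  unfold letterEntry
  split <;> rename_i p hp
  · have h0 : (if l = j then (if i = finRotate ℓ j then (σ j).invElem k else 0) else 0) = 0 := by
      split_ifs with h1 h2
      · rw [← h1, hp]; rfl
      all_goals rfl
    rw [h0, add_zero]
    by_cases h : l = i
    · subst h; simp [hp, Letter.dirElem]
    · simp [h, Ne.symm h]
  · have h0 : (if l = i then (if j = finRotate ℓ i then (σ i).dirElem k else 0) else 0) = 0 := by
      split_ifs with h1 h2
      · rw [← h1, hp]; rfl
      all_goals rfl
    rw [h0, zero_add]
    by_cases h : l = j
    · subst h; simp [hp, Letter.invElem]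
    · simp [h, Ne.symm h]

lemma entry_eq {ℓ : ℕ} (σ : Fin ℓ → Letter R) (m : Fin ℓ) (c : k) (i j : Fin ℓ) :
    entry k σ m c i j =
      (if j = finRotate ℓ i then (if i = m then c else 1) • (σ i).dirElem k else 0) +
      (if i = finRotate ℓ j then (if j = m then c else 1) • (σ j).invElem k else 0) := by
  unfold entry
  simp only [letterEntry_eq, smul_add, Finset.sum_add_distrib, smul_ite, smul_zero,
    Finset.sum_ite_eq', Finset.mem_univ, if_true]

end Entries

/-! ### Chain maps given by scalar matrices. -/

section ScalarMaps

variable {V : Type v} [Quiver.{w} V] {R : Quiver.Total V → Quiver.Total V → Prop}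
variable {k : Type u} [Field k] [Fintype V]

lemma smul_mem_proj {x : V} (a : k) {z : BoundAlgebra k R} (hz : z ∈ proj k R x) :
    a • z ∈ proj k R x := by
  rw [Algebra.smul_def]
  exact (proj k R x).smul_mem _ hz

/-- The component of degree `a` of the complex of a word. -/
abbrev Chain (k : Type u) [Field k] {ℓ : ℕ} (σ : Fin ℓ → Letter R) (a : ℤ) :=
  (j : {j : Fin ℓ // deg σ j = a}) → proj k R (vertex σ j)

/-- Extension by zero of an element of degree `a` to all positions. -/
def extend {ℓ : ℕ} (σ : Fin ℓ → Letter R) (a : ℤ) (x : Chain k σ a) (j : Fin ℓ) :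
    BoundAlgebra k R :=
  if h : deg σ j = a then (x ⟨j, h⟩ : BoundAlgebra k R) else 0

section

variable {ℓ : ℕ} {σ : Fin ℓ → Letter R} {a : ℤ}

/-- Extended chains take values in the algebra itself, so chains of different words can be compared
without transport along equalities of vertices or degrees. -/
lemma extend_mem (x : Chain k σ a) (j : Fin ℓ) : extend σ a x j ∈ proj k R (vertex σ j) := by
  unfold extend
  split_ifs with h
  · exact (x ⟨j, h⟩).2
  · exact Submodule.zero_mem _

lemma extend_apply (x : Chain k σ a) (j : {j : Fin ℓ // deg σ j = a}) :
    extend σ a x j = x j := dif_pos j.2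

lemma extend_of_ne (x : Chain k σ a) {j : Fin ℓ} (h : deg σ j ≠ a) : extend σ a x j = 0 :=
  dif_neg h

lemma extend_add (x y : Chain k σ a) (j : Fin ℓ) :
    extend σ a (x + y) j = extend σ a x j + extend σ a y j := by
  unfold extend
  split_ifs
  · rfl
  · exact (add_zero _).symm

lemma extend_smul (b : BoundAlgebra k R) (x : Chain k σ a) (j : Fin ℓ) :
    extend σ a (b • x) j = b • extend σ a x j := by
  unfold extend
  split_ifs
  · rfl
  · exact (smul_zero _).symm

lemma extend_injective {x y : Chain k σ a} (h : ∀ j, extend σ a x j = extend σ a y j) :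
    x = y :=
  funext fun j => Subtype.ext <| by rw [← extend_apply, ← extend_apply, h]

lemma blockMap_coe (h : IsClosedWord σ) (m : Fin ℓ) (c : k) (b : ℤ) (x : Chain k σ a)
    (t : {j : Fin ℓ // deg σ j = b}) :
    (blockMap h m c a b x t : BoundAlgebra k R) = ∑ i, extend σ a x i * entry k σ m c i t := by
  simp only [blockMap, LinearMap.comp_apply, LinearMap.pi_apply, LinearMap.sum_apply,
    LinearMap.proj_apply, rightMul, LinearMap.coe_mk, AddHom.coe_mk, Submodule.coe_sum]
  rw [← Finset.sum_subset (Finset.subset_univ (Finset.univ.filter fun i => deg σ i = a))]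
  · rw [Finset.sum_subtype (p := fun i => deg σ i = a) _ (by simp)]
    exact Finset.sum_congr rfl fun i _ => by rw [extend_apply]
  · intro i _ hi
    rw [extend_of_ne _ (by simpa using hi), zero_mul]

end

variable {N M K : ℕ} (σ : Fin N → Letter R) (τ : Fin M → Letter R) (ρ : Fin K → Letter R)

/-- A matrix of scalars between positions of two words which only connects positions with the same
vertex and the same degree. -/
def Compatible (A : Matrix (Fin N) (Fin M) k) : Prop :=
  ∀ p j, A p j ≠ 0 → vertex σ p = vertex τ j ∧ deg σ p = deg τ j

variable {σ τ ρ}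

/-- The map in degree `a` given by a compatible matrix of scalars. -/
def scalarMap {A : Matrix (Fin N) (Fin M) k} (hA : Compatible σ τ A) (a : ℤ) :
    Chain k σ a →ₗ[BoundAlgebra k R] Chain k τ a where
  toFun x j := ⟨∑ p, A p j • extend σ a x p, Submodule.sum_mem _ fun p _ => by
    by_cases h : A p j = 0
    · rw [h, zero_smul]; exact Submodule.zero_mem _
    · rw [← (hA p j h).1]
      exact smul_mem_proj _ (extend_mem x p)⟩
  map_add' x y := funext fun j => Subtype.ext <| by
    simp [extend_add, smul_add, Finset.sum_add_distrib]
  map_smul' b x := funext fun j => Subtype.ext <| by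
    simp [extend_smul, Finset.mul_sum]

/-- At positions of degree other than `a` both sides vanish, the right one by compatibility; hence
no degree condition is needed on `j`. -/
lemma extend_scalarMap {A : Matrix (Fin N) (Fin M) k} (hA : Compatible σ τ A) (a : ℤ)
    (x : Chain k σ a) (j : Fin M) :
    extend τ a (scalarMap hA a x) j = ∑ p, A p j • extend σ a x p := by
  by_cases h : deg τ j = a
  · exact extend_apply (scalarMap hA a x) ⟨j, h⟩
  · rw [extend_of_ne _ h]
    refine (Finset.sum_eq_zero fun p _ => ?_).symm
    by_cases hp : A p j = 0
    · rw [hp, zero_smul]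
    · rw [extend_of_ne _ ((hA p j hp).2.trans_ne h), smul_zero]

/-- Chains are row vectors here, so matrices multiply in the order in which the maps are applied. -/
lemma extend_scalarMap_scalarMap {A : Matrix (Fin N) (Fin M) k} (hA : Compatible σ τ A)
    {B : Matrix (Fin M) (Fin K) k} (hB : Compatible τ ρ B) (a : ℤ) (x : Chain k σ a) (t : Fin K) :
    extend ρ a (scalarMap hB a (scalarMap hA a x)) t = ∑ p, (A * B) p t • extend σ a x p := by
  simp only [extend_scalarMap, Finset.smul_sum, Matrix.mul_apply, Finset.sum_smul, smul_smul]
  rw [Finset.sum_comm]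
  simp only [mul_comm]

/-- The map of complexes given by a compatible matrix of scalars that intertwines the matrices of
the differentials. -/
def scalarHom (hσ : IsClosedWord σ) (m : Fin N) (c : k) (hτ : IsClosedWord τ) (m' : Fin M) (x : k)
    {A : Matrix (Fin N) (Fin M) k} (hA : Compatible σ τ A)
    (hcomm : ∀ i t, ∑ s, A i s • entry k τ m' x s t = ∑ s, A s t • entry k σ m c i s) :
    bandComplex hσ m c ⟶ bandComplex hτ m' x where
  f a := ModuleCat.ofHom (scalarMap hA a)
  comm' a b hab := by
    have hab' : a + 1 = b := hab
    simp only [bandComplex, if_pos hab', ← ModuleCat.ofHom_comp]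
    congr 1
    refine LinearMap.ext fun u => funext fun t => Subtype.ext ?_
    have h1 : ((scalarMap hA b (blockMap hσ m c a b u) t : proj k R (vertex τ t)) :
        BoundAlgebra k R) = ∑ i, extend σ a u i * ∑ s, A s t • entry k σ m c i s := by
      change ∑ s, A s t • extend σ b (blockMap hσ m c a b u) s = _
      simp only [Finset.mul_sum]
      rw [Finset.sum_comm]
      refine Finset.sum_congr rfl fun s _ => ?_
      -- A nonzero coefficient forces `s` to have degree `b`, where `blockMap_coe` applies.
      by_cases hs : A s t = 0
      · simp [hs]
      · have hd : deg σ s = b := (hA s t hs).2.trans t.2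
        rw [extend_apply _ ⟨s, hd⟩, blockMap_coe, Finset.smul_sum]
        exact Finset.sum_congr rfl fun i _ => (mul_smul_comm _ _ _).symm
    have h2 : ((blockMap hτ m' x a b (scalarMap hA a u) t : proj k R (vertex τ t)) :
        BoundAlgebra k R) = ∑ i, extend σ a u i * ∑ s, A i s • entry k τ m' x s t := by
      rw [blockMap_coe]
      simp only [extend_scalarMap, Finset.sum_mul, Finset.mul_sum]
      rw [Finset.sum_comm]
      simp only [smul_mul_assoc, mul_smul_comm]
    simp only [LinearMap.comp_apply]
    rw [h1, h2]
    simp only [hcomm]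

end ScalarMaps

end GentleBand

end

noncomputable section

namespace GentleBand

/-! ### The gauge and the discrete Fourier transform. -/

section Gauge

variable {k : Type u} [Field k] {n ℓ : ℕ}

/-- The scalars by which the positions of the `n`-th power of a word of length `ℓ` are rescaled in
order to spread a scalar `c = x ^ n` placed at position `m` to scalars `x` placed at all the
positions congruent to `m'`. -/
def gauge (m : Fin (n * ℓ)) (m' : Fin ℓ) (c x : k) (p : Fin (n * ℓ)) : k :=
  x ^ (p.divNat : ℕ) * ((if m' < p.modNat then x else 1) * (if m < p then c⁻¹ else 1))

lemma gauge_ne_zero (m : Fin (n * ℓ)) (m' : Fin ℓ) {c x : k} (hc : c ≠ 0) (hx : x ≠ 0)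
    (p : Fin (n * ℓ)) : gauge m m' c x p ≠ 0 := by
  unfold gauge
  refine mul_ne_zero (pow_ne_zero _ hx) (mul_ne_zero ?_ ?_) <;> split_ifs <;> simp [hc, hx]

lemma gauge_finRotate (m : Fin (n * ℓ)) (m' : Fin ℓ) {c x : k} (hc : c ≠ 0) (hx : x ^ n = c)
    (p : Fin (n * ℓ)) :
    gauge m m' c x (finRotate (n * ℓ) p) * (if p = m then c else 1) =
      gauge m m' c x p * (if p.modNat = m' then x else 1) := by
  have hℓ : 0 < ℓ := p.modNat.pos
  obtain ⟨⟨r, j⟩, rfl⟩ := finProdFinEquiv.surjective p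
  have hval : (finProdFinEquiv (r, j) : ℕ) = j + ℓ * r := rfl
  have hm := m.2
  have hm' := m'.2
  have hj := j.2
  have hr := r.2
  unfold gauge
  rw [modNat_finRotate, modNat_finProdFinEquiv, divNat_finProdFinEquiv]
  simp only [Fin.lt_def, Fin.ext_iff, val_divNat, val_finRotate, hval]
  -- the product of the two factors that count the scalar `c`
  have key : ∀ q : ℕ, q = j + ℓ * r + 1 →
      (if (m : ℕ) < q then c⁻¹ else 1) * (if (j + ℓ * r : ℕ) = m then c else 1) =
        if (m : ℕ) < j + ℓ * r then c⁻¹ else 1 := by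
    rintro q rfl
    rcases lt_trichotomy (m : ℕ) (j + ℓ * r) with h | h | h
    · simp [h, h.ne', Nat.lt_succ_of_lt h]
    · simp [h, hc]
    · simp [h.not_gt, h.ne, show ¬ (m : ℕ) < j + ℓ * r + 1 by omega]
  -- Inside a block the power `x ^ r` is unchanged, and the factor for `m'` changes exactly on
  -- passing `m'`.
  by_cases hjl : (j : ℕ) + 1 < ℓ
  · have hlt : j + ℓ * r + 1 < n * ℓ := by nlinarith
    rw [Nat.mod_eq_of_lt hlt, Nat.mod_eq_of_lt hjl, mul_assoc, mul_assoc, key _ rfl,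
      show (j + ℓ * r + 1) / ℓ = (r : ℕ) by
        rw [add_right_comm, Nat.add_mul_div_left _ _ hℓ, Nat.div_eq_of_lt hjl, zero_add]]
    rcases lt_trichotomy (m' : ℕ) j with h | h | h
    · simp [h, h.ne', Nat.lt_succ_of_lt h]
    · simp [h]
      ring_nf
    · simp [h.not_gt, h.ne, show ¬ (m' : ℕ) < j + 1 by omega]
  · have hjl' : (j : ℕ) + 1 = ℓ := by omega
    -- At the end of a block `m'` has been passed once; the factor `x` so collected moves into the
    -- power of `x` for the next block.
    have hx' : (if (m' : ℕ) < j then x else 1) * (if (j : ℕ) = m' then x else 1) = x := by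
      rcases (show (m' : ℕ) ≤ j by omega).lt_or_eq with h | h
      · simp [h, h.ne']
      · simp [h]
    have hq : j + ℓ * r + 1 = (r + 1) * ℓ := by rw [Nat.succ_mul, mul_comm ℓ]; omega
    rw [hjl', Nat.mod_self, if_neg (Nat.not_lt_zero _)]
    by_cases hrn : (r : ℕ) + 1 < n
    · rw [Nat.mod_eq_of_lt (hq.trans_lt (Nat.mul_lt_mul_of_pos_right hrn hℓ)), ← key _ rfl, hq,
        Nat.mul_div_cancel _ hℓ]
      linear_combination (-(x ^ (r : ℕ) * (if (m : ℕ) < (r + 1) * ℓ then c⁻¹ else 1) *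
        (if (j + ℓ * r : ℕ) = m then c else 1))) * hx'
    -- The last position wraps around to `0`, where the gauge is `1`. The full circuit has collected
    -- `x ^ n * c⁻¹`, so `x ^ n = c` closes it up.
    · have hrn' : (r : ℕ) + 1 = n := by omega
      have hxc : x ^ (r : ℕ) * x = c := by rw [← pow_succ, hrn', hx]
      rw [← key _ rfl, hq, hrn', if_pos hm, Nat.mod_self, Nat.zero_div,
        if_neg (Nat.not_lt_zero _)]
      generalize (if (j + ℓ * r : ℕ) = m then c else 1) = z
      linear_combination (-(x ^ (r : ℕ) * c⁻¹ * z)) * hx' - (c⁻¹ * z) * hxc -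
        z * mul_inv_cancel₀ hc

/-- The matrix of the rescaled inclusion of a word into its power. -/
def inclMatrix (g : Fin (n * ℓ) → k) : Matrix (Fin ℓ) (Fin (n * ℓ)) k :=
  fun j p => if p.modNat = j then (g p)⁻¹ else 0

/-- The matrix of the rescaled folding of a power of a word onto the word. -/
def foldMatrix (g : Fin (n * ℓ) → k) : Matrix (Fin (n * ℓ)) (Fin ℓ) k :=
  fun p j => if p.modNat = j then (n : k)⁻¹ * g p else 0

/-- The factor `c⁻¹` does not depend on the root and cancels, leaving a geometric progression in the
block index. -/
lemma gauge_mul_inv (m : Fin (n * ℓ)) (m' : Fin ℓ) {c : k} (hc : c ≠ 0) {x y : k}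
    (hx : x ≠ 0) (hy : y ≠ 0) (r : Fin n) (j : Fin ℓ) :
    (gauge m m' c x (finProdFinEquiv (r, j)))⁻¹ * gauge m m' c y (finProdFinEquiv (r, j)) =
      (y / x) ^ (r : ℕ) * if m' < j then y / x else 1 := by
  unfold gauge
  rw [divNat_finProdFinEquiv, modNat_finProdFinEquiv]
  simp only [div_pow]
  split_ifs <;> field_simp

/-- Orthogonality of the characters of `ℤ/n`. -/
lemma sum_pow_div_pow {ω : k} (hω : IsPrimitiveRoot ω n) (a b : Fin n) :
    ∑ r : Fin n, (ω ^ (b : ℕ) / ω ^ (a : ℕ)) ^ (r : ℕ) = if a = b then (n : k) else 0 := by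
  have hn : n ≠ 0 := a.pos.ne'
  have h0 : ω ≠ 0 := hω.ne_zero hn
  split_ifs with h
  · subst h
    simp [div_self (pow_ne_zero _ h0)]
  · rw [Fin.sum_univ_eq_sum_range (fun r => (ω ^ (b : ℕ) / ω ^ (a : ℕ)) ^ r)]
    have h1 : ω ^ (b : ℕ) / ω ^ (a : ℕ) ≠ 1 := by
      rw [Ne, div_eq_one_iff_eq (pow_ne_zero _ h0)]
      exact fun e => h (Fin.ext (hω.pow_inj a.2 b.2 e.symm))
    rw [geom_sum_eq h1, div_pow, ← pow_mul, ← pow_mul, mul_comm (b : ℕ), mul_comm (a : ℕ),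
      pow_mul, pow_mul, hω.pow_eq_one]
    simp

lemma inclMatrix_mul_foldMatrix (m : Fin (n * ℓ)) (m' : Fin ℓ) {c μ ω : k} (hc : c ≠ 0)
    (hμ : μ ≠ 0) (hω : IsPrimitiveRoot ω n) (a b : Fin n) :
    inclMatrix (gauge m m' c (ω ^ ((a : ℕ) + 1) * μ)) *
      foldMatrix (gauge m m' c (ω ^ ((b : ℕ) + 1) * μ)) = if a = b then 1 else 0 := by
  have hn : n ≠ 0 := a.pos.ne'
  have h0 : ω ≠ 0 := hω.ne_zero hn
  have : NeZero n := ⟨hn⟩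
  -- A primitive `n`-th root of unity in `k` forces the characteristic not to divide `n`.
  have hnk : (n : k) ≠ 0 := (hω.neZero').ne
  have hne : ∀ i : ℕ, ω ^ (i + 1) * μ ≠ 0 := fun i => mul_ne_zero (pow_ne_zero _ h0) hμ
  have hdiv : ω ^ ((b : ℕ) + 1) * μ / (ω ^ ((a : ℕ) + 1) * μ) = ω ^ (b : ℕ) / ω ^ (a : ℕ) := by
    rw [pow_succ, pow_succ]; field_simp
  ext j t
  simp only [Matrix.mul_apply, inclMatrix, foldMatrix, ite_mul, zero_mul]
  rw [sum_fiber_modNat]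
  simp only [modNat_finProdFinEquiv, mul_ite, mul_zero]
  by_cases hjt : j = t
  · subst hjt
    simp only [if_true, mul_left_comm _ (n : k)⁻¹, gauge_mul_inv m m' hc (hne a) (hne b), hdiv]
    rw [← Finset.mul_sum, ← Finset.sum_mul, sum_pow_div_pow hω]
    by_cases hab : a = b
    · subst hab
      simp [div_self (pow_ne_zero (a : ℕ) h0), hnk]
    · simp [hab]
  · by_cases hab : a = b
    · simp [hjt, hab]
    · simp [hjt, hab]

lemma sum_foldMatrix_mul_inclMatrix (m : Fin (n * ℓ)) (m' : Fin ℓ) {c μ ω : k} (hc : c ≠ 0)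
    (hμ : μ ≠ 0) (hω : IsPrimitiveRoot ω n) :
    ∑ a : Fin n, foldMatrix (gauge m m' c (ω ^ ((a : ℕ) + 1) * μ)) *
      inclMatrix (gauge m m' c (ω ^ ((a : ℕ) + 1) * μ)) = 1 := by
  let P : Matrix (Fin (n * ℓ)) (Fin n × Fin ℓ) k :=
    fun p i => foldMatrix (gauge m m' c (ω ^ ((i.1 : ℕ) + 1) * μ)) p i.2
  let Q : Matrix (Fin n × Fin ℓ) (Fin (n * ℓ)) k :=
    fun i p => inclMatrix (gauge m m' c (ω ^ ((i.1 : ℕ) + 1) * μ)) i.2 p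
  have hQP : Q * P = 1 := by
    ext i t
    have h := congrArg (fun A : Matrix (Fin ℓ) (Fin ℓ) k => A i.2 t.2)
      (inclMatrix_mul_foldMatrix m m' hc hμ hω i.1 t.1)
    refine Eq.trans h ?_
    by_cases h1 : i.1 = t.1
    · simp [h1, Matrix.one_apply, Prod.ext_iff]
    · simp [h1, Prod.ext_iff]
  -- The index types have the same cardinality, so a left inverse is a right inverse.
  have hPQ : P * Q = 1 := (Matrix.mul_eq_one_comm_of_equiv finProdFinEquiv).1 hQP
  rw [← hPQ]
  ext p q
  rw [Matrix.sum_apply, Matrix.mul_apply, Fintype.sum_prod_type]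
  rfl

end Gauge

/-! ### Inclusion and folding commute with the differentials. -/

section Power

variable {V : Type v} [Quiver.{w} V] {R : Quiver.Total V → Quiver.Total V → Prop}
variable {k : Type u} [Field k] {n ℓ : ℕ} {τ : Fin ℓ → Letter R}

lemma compatible_inclMatrix (hτ : IsClosedWord τ) (g : Fin (n * ℓ) → k) :
    Compatible τ (Fin.repeat n τ) (inclMatrix g) := by
  intro j p h
  have hj : p.modNat = j := by
    by_contra hne
    exact h (if_neg hne)
  subst hj
  exact ⟨rfl, (deg_repeat hτ n p).symm⟩

lemma compatible_foldMatrix (hτ : IsClosedWord τ) (g : Fin (n * ℓ) → k) :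
    Compatible (Fin.repeat n τ) τ (foldMatrix g) := by
  intro p j h
  have hj : p.modNat = j := by
    by_contra hne
    exact h (if_neg hne)
  subst hj
  exact ⟨rfl, deg_repeat hτ n p⟩

/-- A family of scalars that spreads the scalar `c` at position `m` of the power of a word to the
scalar `x` at position `m'` of the word. -/
def IsGauge (m : Fin (n * ℓ)) (m' : Fin ℓ) (c x : k) (g : Fin (n * ℓ) → k) : Prop :=
  ∀ p, g (finRotate (n * ℓ) p) * (if p = m then c else 1) = g p * (if p.modNat = m' then x else 1)

variable [Fintype V] {m : Fin (n * ℓ)} {m' : Fin ℓ} {c x : k} {g : Fin (n * ℓ) → k}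

/-- The scalars sit on direct letters, so an inverse letter carries `1` in both words and the gauge
agrees at its two ends. -/
lemma smul_invElem_eq (hm : (Fin.repeat n τ m).IsDirect) (hm' : (τ m').IsDirect)
    (hg : IsGauge m m' c x g) (p : Fin (n * ℓ)) :
    (if p = m then c else 1) • (τ p.modNat).invElem k = (τ p.modNat).invElem k ∧
    (if p.modNat = m' then x else 1) • (τ p.modNat).invElem k = (τ p.modNat).invElem k ∧
    (g (finRotate (n * ℓ) p) = g p ∨ (τ p.modNat).invElem k = 0) := by
  by_cases hp : (τ p.modNat).IsDirect
  · simp [Letter.invElem_of_isDirect hp]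
  · have h1 : p ≠ m := fun e => hp (e ▸ hm)
    have h2 : p.modNat ≠ m' := fun e => hp (e ▸ hm')
    have := hg p
    simp only [h1, h2, if_false, mul_one] at this
    simp only [h1, h2, if_false, one_smul, this, true_or, and_self]

/-- Into `q` only the direct letter from its predecessor and the inverse letter from its successor
contribute. The gauge equation settles the former, `smul_invElem_eq` the latter. -/
lemma inclMatrix_intertwines (hm : (Fin.repeat n τ m).IsDirect) (hm' : (τ m').IsDirect)
    (hg : IsGauge m m' c x g) (hg0 : ∀ p, g p ≠ 0) (i : Fin ℓ) (q : Fin (n * ℓ)) :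
    ∑ p, inclMatrix g i p • entry k (Fin.repeat n τ) m c p q =
      ∑ j, inclMatrix g j q • entry k τ m' x i j := by
  have hR : ∑ j, inclMatrix g j q • entry k τ m' x i j = (g q)⁻¹ • entry k τ m' x i q.modNat := by
    simp only [inclMatrix, ite_smul, zero_smul, Finset.sum_ite_eq, Finset.mem_univ, if_true]
  rw [hR]
  simp only [entry_eq, smul_add, Finset.sum_add_distrib, inclMatrix, Fin.repeat_apply]
  congr 1
  · obtain ⟨p, rfl⟩ := (finRotate (n * ℓ)).surjective q
    rw [Finset.sum_eq_single p, if_pos rfl, modNat_finRotate]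
    · by_cases h : p.modNat = i
      · subst h
        simp only [if_true, smul_smul]
        congr 1
        have := hg p
        have h1 := hg0 p
        have h2 := hg0 (finRotate _ p)
        rw [inv_mul_eq_iff_eq_mul₀ h1, mul_left_comm, eq_inv_mul_iff_mul_eq₀ h2, this]
      · rw [if_neg h, zero_smul, if_neg fun e => h ((finRotate ℓ).injective e), smul_zero]
    · intro b _ hb
      rw [if_neg fun e => hb ((finRotate _).injective e).symm, smul_zero]
    · simp
  · obtain ⟨h1, h2, h3⟩ := smul_invElem_eq hm hm' hg q
    rw [Finset.sum_eq_single (finRotate _ q), if_pos rfl, modNat_finRotate, h1, h2]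
    · by_cases h : i = finRotate ℓ q.modNat
      · rw [if_pos h.symm, if_pos h]
        rcases h3 with h3 | h3
        · rw [h3]
        · rw [h3, smul_zero, smul_zero]
      · rw [if_neg (Ne.symm h), if_neg h, zero_smul, smul_zero]
    · intro b _ hb
      rw [if_neg hb, smul_zero]
    · simp

lemma foldMatrix_intertwines (hm : (Fin.repeat n τ m).IsDirect) (hm' : (τ m').IsDirect)
    (hg : IsGauge m m' c x g) (p : Fin (n * ℓ)) (t : Fin ℓ) :
    ∑ s, foldMatrix g p s • entry k τ m' x s t =
      ∑ q, foldMatrix g q t • entry k (Fin.repeat n τ) m c p q := by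
  have hL : ∑ s, foldMatrix g p s • entry k τ m' x s t =
      ((n : k)⁻¹ * g p) • entry k τ m' x p.modNat t := by
    simp only [foldMatrix, ite_smul, zero_smul, Finset.sum_ite_eq, Finset.mem_univ, if_true]
  rw [hL]
  simp only [entry_eq, smul_add, Finset.sum_add_distrib, foldMatrix, Fin.repeat_apply]
  congr 1
  · rw [Finset.sum_eq_single (finRotate _ p), if_pos rfl, modNat_finRotate]
    · by_cases h : t = finRotate ℓ p.modNat
      · rw [if_pos h, if_pos h.symm, smul_smul, smul_smul, mul_assoc, mul_assoc, hg p]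
      · rw [if_neg h, if_neg (Ne.symm h), zero_smul, smul_zero]
    · intro b _ hb
      rw [if_neg hb, smul_zero]
    · simp
  · obtain ⟨q, rfl⟩ := (finRotate (n * ℓ)).surjective p
    obtain ⟨h1, h2, h3⟩ := smul_invElem_eq hm hm' hg q
    rw [Finset.sum_eq_single q, if_pos rfl, modNat_finRotate, h1]
    · by_cases h : q.modNat = t
      · subst h
        rw [if_pos rfl, if_pos rfl, h2]
        rcases h3 with h3 | h3
        · rw [h3]
        · rw [h3, smul_zero, smul_zero]
      · rw [if_neg h, zero_smul, if_neg fun e => h ((finRotate ℓ).injective e), smul_zero]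
    · intro b _ hb
      rw [if_neg fun e => hb ((finRotate _).injective e).symm, smul_zero]
    · simp

end Power

end GentleBand

end

noncomputable section

namespace GentleBand

/-! ### The biproduct decomposition. -/

section Splitting

variable {V : Type v} [Quiver.{w} V] {R : Quiver.Total V → Quiver.Total V → Prop}
variable {k : Type u} [Field k] [Fintype V] {n ℓ : ℕ} {τ : Fin ℓ → Letter R}
variable (hτ : IsClosedWord τ) {m : Fin (n * ℓ)} {m' : Fin ℓ}
variable (hm : (Fin.repeat n τ m).IsDirect) (hm' : (τ m').IsDirect)
variable {c x : k} (hc : c ≠ 0) (hx : x ^ n = c)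

lemma ne_zero_of_pow_eq (hc : c ≠ 0) (hx : x ^ n = c) (m : Fin (n * ℓ)) : x ≠ 0 := by
  have hn : n ≠ 0 := m.divNat.pos.ne'
  rintro rfl
  exact hc (by rw [← hx, zero_pow hn])

/-- The inclusion of `B_{τ,x}` into `B_{σ,c}`, where `σ` is the `n`-th power of `τ` and
`x ^ n = c`. -/
def bandIncl : bandComplex hτ m' x ⟶ bandComplex (hτ.pow n) m c :=
  scalarHom hτ m' x (hτ.pow n) m c (compatible_inclMatrix hτ (gauge m m' c x))
    (inclMatrix_intertwines hm hm' (gauge_finRotate m m' hc hx)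
      (gauge_ne_zero m m' hc (ne_zero_of_pow_eq hc hx m)))

/-- The projection of `B_{σ,c}` onto `B_{τ,x}`, where `σ` is the `n`-th power of `τ` and
`x ^ n = c`. -/
def bandFold : bandComplex (hτ.pow n) m c ⟶ bandComplex hτ m' x :=
  scalarHom (hτ.pow n) m c hτ m' x (compatible_foldMatrix hτ (gauge m m' c x))
    (foldMatrix_intertwines hm hm' (gauge_finRotate m m' hc hx))

lemma pow_mul_pow_eq {ω μ : k} (hω : IsPrimitiveRoot ω n) (hμ : μ ^ n = c) (i : ℕ) :
    (ω ^ i * μ) ^ n = c := by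
  rw [mul_pow, ← pow_mul, mul_comm i, pow_mul, hω.pow_eq_one, one_pow, one_mul, hμ]

/-- The bicone with point `B_{σ,c}` over the complexes `B_{τ,x}`, where `x` runs through the
`n`-th roots of `c`. -/
def bandBicone {ω μ : k} (hω : IsPrimitiveRoot ω n) (hμ : μ ^ n = c) :
    Bicone fun i : Fin n => bandComplex hτ m' (ω ^ ((i : ℕ) + 1) * μ) where
  pt := bandComplex (hτ.pow n) m c
  π i := bandFold hτ hm hm' hc (pow_mul_pow_eq hω hμ (i + 1))
  ι i := bandIncl hτ hm hm' hc (pow_mul_pow_eq hω hμ (i + 1))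
  ι_π a b := by
    have key : ∀ (d : ℤ) (y : Chain k τ d) (t : Fin ℓ), _ := fun d y t =>
      extend_scalarMap_scalarMap
        (compatible_inclMatrix hτ (gauge m m' c (ω ^ ((a : ℕ) + 1) * μ)))
        (compatible_foldMatrix hτ (gauge m m' c (ω ^ ((b : ℕ) + 1) * μ))) d y t
    simp only [inclMatrix_mul_foldMatrix m m' hc (ne_zero_of_pow_eq hc hμ m) hω a b] at key
    split_ifs with hab
    · subst hab
      ext d y
      refine extend_injective fun t => (key d y t).trans ?_
      simp only [if_true, Matrix.one_apply, ite_smul, one_smul, zero_smul, Finset.sum_ite_eq',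
        Finset.mem_univ]
      rfl
    · ext d y
      refine extend_injective fun t => (key d y t).trans ?_
      simp only [if_neg hab, Matrix.zero_apply, zero_smul, Finset.sum_const_zero]
      -- The extension of the zero chain is `0` in both branches of its definition.
      exact (ite_self _).symm

lemma extend_sum {ι : Type*} {σ : Fin ℓ → Letter R} {d : ℤ} (s : Finset ι) (y : ι → Chain k σ d)
    (j : Fin ℓ) : extend σ d (∑ i ∈ s, y i) j = ∑ i ∈ s, extend σ d (y i) j := by
  classical
  induction s using Finset.induction_on with
  | empty => exact ite_self _
  | insert i s hi ih => rw [Finset.sum_insert hi, Finset.sum_insert hi, extend_add, ih]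

lemma sum_scalarMap_comp_scalarMap (m' : Fin ℓ) (m : Fin (n * ℓ)) (hc : c ≠ 0) {ω μ : k}
    (hω : IsPrimitiveRoot ω n) (hμ : μ ^ n = c) (d : ℤ) :
    ∑ i : Fin n,
      (scalarMap (compatible_inclMatrix hτ (gauge m m' c (ω ^ ((i : ℕ) + 1) * μ))) d).comp
        (scalarMap (compatible_foldMatrix hτ (gauge m m' c (ω ^ ((i : ℕ) + 1) * μ))) d) =
      LinearMap.id := by
  refine LinearMap.ext fun y => extend_injective fun p => ?_
  simp only [LinearMap.sum_apply, LinearMap.comp_apply, LinearMap.id_apply]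
  rw [extend_sum]
  simp only [extend_scalarMap_scalarMap]
  rw [Finset.sum_comm]
  simp only [← Finset.sum_smul, ← Matrix.sum_apply]
  rw [sum_foldMatrix_mul_inclMatrix m m' hc (ne_zero_of_pow_eq hc hμ m) hω]
  simp only [Matrix.one_apply, ite_smul, one_smul, zero_smul, Finset.sum_ite_eq',
    Finset.mem_univ, if_true]

/-- The complex `B_{σ,c}` is the direct sum of the complexes `B_{τ,x}`. -/
def bandBiconeIsBilimit {ω μ : k} (hω : IsPrimitiveRoot ω n) (hμ : μ ^ n = c) :
    (bandBicone hτ hm hm' hc hω hμ).IsBilimit := by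
  -- In a preadditive category it remains to see that the projections followed by the inclusions sum
  -- to the identity; this is checked in each degree.
  refine isBilimitOfTotal _ ?_
  ext d : 1
  refine ModuleCat.hom_ext (Eq.trans ?_ (sum_scalarMap_comp_scalarMap hτ m' m hc hω hμ d))
  exact (congrArg ModuleCat.Hom.hom ((HomologicalComplex.eval _ _ d).map_sum
    (fun i : Fin n => bandFold hτ hm hm' hc (pow_mul_pow_eq hω hμ (i + 1)) ≫
      bandIncl hτ hm hm' hc (pow_mul_pow_eq hω hμ (i + 1))) _)).trans (ModuleCat.hom_sum _ _)

end Splitting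

end GentleBand

end

theorem lemma2p5 {k : Type u} [Field k] [IsAlgClosed k]
    {V : Type v} [Quiver.{w} V] [Fintype V]
    (R : Quiver.Total V → Quiver.Total V → Prop) (hR : GentleBand.IsGentle R)
    {ℓ : ℕ} (τ : Fin ℓ → GentleBand.Letter R) (hτ : GentleBand.IsHomotopyBand τ)
    (n : ℕ) (hn : 0 < n)
    -- the direct letters of `σ = τ ^ n` and of `τ` that carry the scalars
    (m : Fin (n * ℓ)) (hm : (Fin.repeat n τ m).IsDirect)
    (m' : Fin ℓ) (hm' : (τ m').IsDirect)
    (c : k) (hc : c ≠ 0) (ω : k) (hω : IsPrimitiveRoot ω n) :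
    (∃ μ : k, μ ^ n = c) ∧
      ∀ μ : k, μ ^ n = c →
        Nonempty (GentleBand.bandComplex (hτ.toIsClosedWord.pow n) m c ≅
          ⨁ fun i : Fin n =>
            GentleBand.bandComplex hτ.toIsClosedWord m' (ω ^ ((i : ℕ) + 1) * μ)) :=
  ⟨IsAlgClosed.exists_pow_nat_eq c hn, fun _ hμ =>
    ⟨biproduct.uniqueUpToIso _
      (GentleBand.bandBiconeIsBilimit hτ.toIsClosedWord hm hm' hc hω hμ)⟩⟩
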